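/- **Definitions.** Let $G$ be a real Lie group with Lie algebra $\mathfrak g$. The coadjoint representation of $G$ on $\mathfrak g^*$ is $\langle K(g)F,X\rangle=\langle F,\mathrm{Ad}(g^{-1})X\rangle$; the orbit of $F\in\mathfrak g^*$ is $\Omega_F=\{K(g)F : g\in G\}$, and its dimension is its dimension as an immersed submanifold of $\mathfrak g^*$, i.e. the rank at $1$ of the orbit map $g\mapsto K(g)F$. An *MDn-algebra* is a Lie algebra isomorphic to the Lie algebra of some $n$-dimensional real solvable Lie group each of whose coadjoint orbits has dimension either zero or the maximal dimension of the coadjoint orbits. For $0<m<n$, an *MD$(n,m)$-algebra* is an MDn-algebra whose first derived ideal has dimension $m$. **Theorem 4.5.** Let $n\ge 3$, let $\mathcal G$ be a real vector space with basis $(X_1,\dots,X_n)$, and let $\mathcal G^1=\mathrm{Span}(X_1,\dots,X_{n-1})$. (i) For every invertible real $(n-1)\times(n-1)$ matrix $A=(a_{ij})$ there is a Lie bracket $[\cdot,\cdot]_A$ on $\mathcal G$ with $$[X_i,X_j]_A=0,\qquad [X_n,X_j]_A=\sum_{i=1}^{n-1}a_{ij}X_i\qquad(1\le i,j\le n-1).$$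 With this bracket $\mathcal G$ is an MD$(n,n-1)$-algebra whose first derived ideal is commutative and equal to $\mathcal G^1$, and $A$ is the matrix of $\mathrm{ad}_{X_n}$ on $\mathcal G^1$ in the basis $(X_1,\dots,X_{n-1})$. Moreover $[\cdot,\cdot]_A$ is the only Lie bracket on $\mathcal G$ satisfying the displayed formulas, and also the only one whose first derived ideal is commutative and equal to $\mathcal G^1$ and for which $A$ is the matrix of $\mathrm{ad}_{X_n}$ on $\mathcal G^1$ in the basis $(X_1,\dots,X_{n-1})$. (ii) Let $A,B$ be invertible real $(n-1)\times(n-1)$ matrices. The Lie algebras $(\mathcal G,[\cdot,\cdot]_A)$ and $(\mathcal G,[\cdot,\cdot]_B)$ are isomorphic if and only if there are a real number $c\ne 0$ and an invertible real $(n-1)\times(n-1)$ matrix $C$ with $cA=CBC^{-1}$. -/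

import Mathlib

open scoped Manifold ContDiff

noncomputable section

/-! ### Lie structures on a real vector space -/

/-- A (real) Lie structure on the vector space `V`: an alternating bilinear bracket satisfying the
Jacobi identity. -/
@[ext]
structure LieStructure (V : Type*) [AddCommGroup V] [Module ℝ V] where
  bracket : V →ₗ[ℝ] V →ₗ[ℝ] V
  bracket_self : ∀ x, bracket x x = 0
  jacobi : ∀ x y z,
    bracket x (bracket y z) + bracket y (bracket z x) + bracket z (bracket x y) = 0

namespace LieStructure

variable {V : Type*} [AddCommGroup V] [Module ℝ V]

/-- The vector space `V`, regarded as a Lie algebra by means of the Lie structure `S`. -/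
def Carrier (_S : LieStructure V) : Type _ := V

instance (S : LieStructure V) : AddCommGroup S.Carrier := inferInstanceAs (AddCommGroup V)

instance (S : LieStructure V) : Module ℝ S.Carrier := inferInstanceAs (Module ℝ V)

/-- The identity map of `V`, as a linear equivalence from `V` to the Lie algebra `(V, S)`. -/
def toCarrier (S : LieStructure V) : V ≃ₗ[ℝ] S.Carrier := LinearEquiv.refl ℝ V

theorem bracket_skew (S : LieStructure V) (x y : V) : S.bracket y x = -S.bracket x y := by
  have h := S.bracket_self (x + y)
  simp only [map_add, LinearMap.add_apply, S.bracket_self, zero_add, add_zero] at h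
  exact eq_neg_of_add_eq_zero_left h

instance (S : LieStructure V) : LieRing S.Carrier where
  bracket x y := S.toCarrier (S.bracket (S.toCarrier.symm x) (S.toCarrier.symm y))
  add_lie x y z := by simp
  lie_add x y z := by simp
  lie_self x := by simp [S.bracket_self]
  leibniz_lie x y z := by
    have h := S.jacobi (S.toCarrier.symm x) (S.toCarrier.symm y) (S.toCarrier.symm z)
    simp only [LinearEquiv.symm_apply_apply]
    rw [← map_add]
    congr 1
    rw [S.bracket_skew (S.toCarrier.symm x) (S.toCarrier.symm z),
      S.bracket_skew (S.bracket (S.toCarrier.symm x) (S.toCarrier.symm y)) (S.toCarrier.symm z)] at h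
    simp only [map_neg] at h
    rw [← sub_eq_zero, ← h]
    abel_nf

instance (S : LieStructure V) : LieAlgebra ℝ S.Carrier where
  lie_smul c x y := by
    change S.toCarrier (S.bracket (S.toCarrier.symm x) (S.toCarrier.symm (c • y))) =
      c • S.toCarrier (S.bracket (S.toCarrier.symm x) (S.toCarrier.symm y))
    simp

theorem lie_toCarrier (S : LieStructure V) (x y : V) :
    ⁅S.toCarrier x, S.toCarrier y⁆ = S.toCarrier (S.bracket x y) := rfl

end LieStructure

/-! ### The coadjoint representation of a Lie group

The Lie algebra `GroupLieAlgebra (𝓡 n) G` of a Lie group `G` modelled on `ℝⁿ` is the tangent space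
of `G` at `1`; Mathlib defines it to be (a synonym of) the model space `EuclideanSpace ℝ (Fin n)`.
Its dual is thus written `StrongDual ℝ (EuclideanSpace ℝ (Fin n))`; all linear forms are
continuous here. -/

section Coadjoint

variable {n : ℕ} {G : Type} [Group G] [TopologicalSpace G]
  [ChartedSpace (EuclideanSpace ℝ (Fin n)) G]

variable (n) in
/-- The adjoint representation: `Ad g` is the tangent map at `1` of `x ↦ g x g⁻¹`. (The target is
the tangent space at `g 1 g⁻¹ = 1`.) -/
def groupAd (g : G) : EuclideanSpace ℝ (Fin n) →L[ℝ] EuclideanSpace ℝ (Fin n) :=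
  mfderiv (𝓡 n) (𝓡 n) (fun x : G ↦ g * x * g⁻¹) 1

variable (n) in
/-- The coadjoint representation: `⟨K g F, X⟩ = ⟨F, Ad g⁻¹ X⟩`. -/
def groupCoad (g : G) (F : StrongDual ℝ (EuclideanSpace ℝ (Fin n))) :
    StrongDual ℝ (EuclideanSpace ℝ (Fin n)) :=
  F.comp (groupAd n g⁻¹)

variable (G) in
/-- The tangent space at `F` of the coadjoint orbit `Ω_F = {K g F | g ∈ G}`. The orbit is an
immersed submanifold of the dual, as the image of the injective immersion `G ⧸ G_F → 𝓖*` induced by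
the orbit map `g ↦ K g F`, so its tangent space at `F` is the range of the differential of the
orbit map at `1`. -/
def coadOrbitTangentSpace (F : StrongDual ℝ (EuclideanSpace ℝ (Fin n))) :
    Submodule ℝ (StrongDual ℝ (EuclideanSpace ℝ (Fin n))) :=
  LinearMap.range
    (mfderiv (𝓡 n) 𝓘(ℝ, StrongDual ℝ (EuclideanSpace ℝ (Fin n)))
      (fun g : G ↦ groupCoad n g F) 1 :
      EuclideanSpace ℝ (Fin n) →L[ℝ] StrongDual ℝ (EuclideanSpace ℝ (Fin n))).toLinearMap

variable (G) in
/-- The dimension of the coadjoint orbit of `F`. -/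
def coadOrbitDim (F : StrongDual ℝ (EuclideanSpace ℝ (Fin n))) : ℕ :=
  Module.finrank ℝ (coadOrbitTangentSpace G F)

end Coadjoint

/-! ### MD-groups and MD-algebras -/

/-- A smooth Lie group is smooth enough for Mathlib's bracket on `GroupLieAlgebra`. -/
instance lieGroupMinSmoothness (n : ℕ) (G : Type) [Group G] [TopologicalSpace G]
    [ChartedSpace (EuclideanSpace ℝ (Fin n)) G] [LieGroup (𝓡 n) ∞ G] :
    LieGroup (𝓡 n) (minSmoothness ℝ 3) G :=
  LieGroup.of_le (n := ∞) (by
    rw [minSmoothness_of_isRCLikeNormedField]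
    exact ENat.LEInfty.out)

/-- An `MDn`-group: an `n`-dimensional real solvable Lie group all of whose coadjoint orbits have
dimension zero or maximal dimension. -/
structure IsMDGroup (n : ℕ) (G : Type) [Group G] [TopologicalSpace G]
    [ChartedSpace (EuclideanSpace ℝ (Fin n)) G] [LieGroup (𝓡 n) ∞ G] : Prop where
  t2Space : T2Space G
  secondCountable : SecondCountableTopology G
  solvable : Group.IsSolvable G
  orbits : ∀ F : StrongDual ℝ (EuclideanSpace ℝ (Fin n)),
    coadOrbitDim G F = 0 ∨
      ∀ F' : StrongDual ℝ (EuclideanSpace ℝ (Fin n)), coadOrbitDim G F' ≤ coadOrbitDim G F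

/-- An `MDn`-algebra: (up to isomorphism) the Lie algebra of an `MDn`-group. -/
def IsMDAlgebra (n : ℕ) (L : Type*) [LieRing L] [LieAlgebra ℝ L] : Prop :=
  ∃ (G : Type) (_ : Group G) (_ : TopologicalSpace G)
    (_ : ChartedSpace (EuclideanSpace ℝ (Fin n)) G) (_ : LieGroup (𝓡 n) ∞ G),
    IsMDGroup n G ∧ Nonempty (GroupLieAlgebra (𝓡 n) G ≃ₗ⁅ℝ⁆ L)

/-- An `MD(n, m)`-algebra: an `MDn`-algebra whose first derived ideal has dimension `m`, where
`0 < m < n`. -/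
structure IsMDAlgebraOfDerivedDim (n m : ℕ) (L : Type*) [LieRing L] [LieAlgebra ℝ L] : Prop where
  pos : 0 < m
  lt : m < n
  isMD : IsMDAlgebra n L
  finrank_derived : Module.finrank ℝ (LieAlgebra.derivedSeries ℝ L 1) = m

/-! ### The Lie structure defined by a matrix -/

section MatrixStructure

variable {m : ℕ} {V : Type*} [AddCommGroup V] [Module ℝ V]

/-- The span of the first `m` of the `m + 1` basis vectors. -/
def spanInit (X : Module.Basis (Fin (m + 1)) ℝ V) : Submodule ℝ V :=
  Submodule.span ℝ (Set.range fun i : Fin m ↦ X i.castSucc)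

/-- `A` is the matrix of `ad` of the last basis vector on the span of the others, in the basis
formed by the others (the columns of `A` are the coordinates of the images). -/
def LieStructure.HasAdMatrix (S : LieStructure V) (X : Module.Basis (Fin (m + 1)) ℝ V)
    (A : Matrix (Fin m) (Fin m) ℝ) : Prop :=
  ∀ j : Fin m, S.bracket (X (Fin.last m)) (X j.castSucc) = ∑ i : Fin m, A i j • X i.castSucc

/-- The first derived ideal of `(V, S)` is commutative, equals the span of the first `m` basis
vectors, and `A` is the matrix on it of `ad` of the last basis vector. -/
structure LieStructure.HasDerivedIdealAndAd (S : LieStructure V)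
    (X : Module.Basis (Fin (m + 1)) ℝ V) (A : Matrix (Fin m) (Fin m) ℝ) : Prop where
  derived_abelian : IsLieAbelian (LieAlgebra.derivedSeries ℝ S.Carrier 1)
  derived_eq : (LieAlgebra.derivedSeries ℝ S.Carrier 1).toSubmodule =
    (spanInit X).map S.toCarrier.toLinearMap
  adMatrix : S.HasAdMatrix X A

/-- `S` is the Lie structure defined by `A`: the first `m` basis vectors commute with each other,
and `ad` of the last basis vector acts on their span by `A`. -/
structure LieStructure.IsDefinedBy (S : LieStructure V) (X : Module.Basis (Fin (m + 1)) ℝ V)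
    (A : Matrix (Fin m) (Fin m) ℝ) : Prop where
  comm : ∀ i j : Fin m, S.bracket (X i.castSucc) (X j.castSucc) = 0
  adMatrix : S.HasAdMatrix X A

end MatrixStructure

end

/-! Let `l` be the last coordinate and `D` the endomorphism acting by `A` on the span of the first
`m` basis vectors and killing the last one. Everything follows from the formula `[v, w] = l v • D w
- l w • D v` with `l ∘ D = 0`.

This algebra integrates explicitly: `x * y = x + exp (l x • D) y` is a group law on the whole vector
space, with one chart. The differential of the orbit map of `F` sends `u` to `F (D u) • l - l u • F
∘ D`, so orbits have dimension 0 or 2 (`twistedGroup_coadOrbitDim`), which is the MD condition.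

When `A` is invertible, `range D = ker l` is the derived ideal. An isomorphism therefore preserves
`ker l` and multiplies `l` by some `c ≠ 0`; comparing brackets with the last basis vector makes its
restriction to `ker l` intertwine `A` with `c • B`. Conversely, such an intertwiner extends by a
scalar on the last vector. -/

theorem mlieBracket_eq_lieBracket {E : Type*} [NormedAddCommGroup E] [NormedSpace ℝ E]
    (V W : Π x : E, TangentSpace 𝓘(ℝ, E) x) (x : E) :
    VectorField.mlieBracket 𝓘(ℝ, E) V W x = VectorField.lieBracket ℝ V W x := by
  rw [← VectorField.mlieBracketWithin_univ, VectorField.mlieBracketWithin_eq_lieBracketWithin]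
  exact congrFun (VectorField.lieBracketWithin_univ (𝕜 := ℝ) (V := V) (W := W)) x

/-! ### The group `E` with the law `x * y = x + exp (l x • D) y` -/

section TwistedGroup

open NormedSpace

variable {E : Type*} [NormedAddCommGroup E] [NormedSpace ℝ E] [CompleteSpace E]
  (l : StrongDual ℝ E) (D : E →L[ℝ] E)

theorem exp_smul_add (s t : ℝ) : exp ((s + t) • D) = exp (s • D) * exp (t • D) := by
  let _ : NormedAlgebra ℚ (E →L[ℝ] E) := NormedAlgebra.restrictScalars ℚ ℝ _
  rw [add_smul]
  exact exp_add_of_commute (((Commute.refl D).smul_left s).smul_right t)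

theorem exp_smul_add_apply (s t : ℝ) (x : E) :
    exp ((s + t) • D) x = exp (s • D) (exp (t • D) x) := by
  rw [exp_smul_add]; rfl

theorem contDiff_exp_smul {k : ℕ∞ω} : ContDiff ℝ k fun t : ℝ ↦ exp (t • D) := by
  have h : ContDiff ℝ k (exp : (E →L[ℝ] E) → (E →L[ℝ] E)) :=
    contDiff_iff_contDiffAt.2 fun x ↦ (exp_analytic (𝕂 := ℝ) x).contDiffAt
  exact h.comp (contDiff_id.smul contDiff_const)

variable {l D}

/-- The derivative in `t` is `l` of a value of `D`, hence zero. This is what makes `l` additive for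
the twisted law. -/
theorem apply_exp_smul (hl : ∀ x, l (D x) = 0) (t : ℝ) (x : E) : l (exp (t • D) x) = l x := by
  have hd (s : ℝ) : HasDerivAt (fun t : ℝ ↦ l (exp (t • D) x)) 0 s := by
    have h := (hasDerivAt_exp_smul_const' (𝕂 := ℝ) D s).clm_apply (hasDerivAt_const s x)
    have h' := l.hasFDerivAt.comp_hasDerivAt s h
    simpa [hl, Function.comp_def] using! h'
  have := is_const_of_deriv_eq_zero (fun s ↦ (hd s).differentiableAt) (fun s ↦ (hd s).deriv) t 0
  simpa using this

variable (l D) in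
theorem hasFDerivAt_exp_smul : HasFDerivAt (fun x ↦ exp (l x • D)) (l.smulRight D) 0 := by
  have h : HasDerivAt (fun t : ℝ ↦ exp (t • D)) D (l 0) := by
    simpa using hasDerivAt_exp_smul_const' (𝕂 := ℝ) D (l 0)
  exact (h.hasFDerivAt.comp (0 : E) l.hasFDerivAt :)

variable (l D) in
theorem hasFDerivAt_exp_smul_apply (y : E) :
    HasFDerivAt (fun x ↦ exp (l x • D) y) (l.smulRight (D y)) 0 := by
  convert (hasFDerivAt_exp_smul l D).clm_apply (hasFDerivAt_const y 0) using 1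
  ext; simp

variable (l D) in
/-- The derivative at `0` of conjugation by the inverse of `g` in `twistedGroup l D`. -/
theorem hasFDerivAt_twisted_conj (g : E) :
    HasFDerivAt (fun x ↦ -exp (-l g • D) g + exp (-l g • D) (x + exp (l x • D) g))
      ((exp (-l g • D)).comp (.id ℝ E + l.smulRight (D g))) 0 :=
  ((exp (-l g • D)).hasFDerivAt.comp (0 : E)
    ((hasFDerivAt_id (0 : E)).add (hasFDerivAt_exp_smul_apply l D g))).const_add _

-- Product rule at `0`: the exponential contributes `-l u • F ∘ D`, the other factor `F (D u) • l`.
-- The function differentiated is `g ↦ K g F` in the twisted group.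
variable (l D) in
theorem fderiv_twisted_coadjoint (F : StrongDual ℝ E) (u v : E) :
    fderiv ℝ (fun g ↦ F.comp ((exp (-l g • D)).comp (.id ℝ E + l.smulRight (D g)))) 0 u v =
      l v * F (D u) - l u * F (D v) := by
  have hP : HasFDerivAt (fun g ↦ exp (-l g • D)) ((-l).smulRight D) 0 :=
    hasFDerivAt_exp_smul (-l) D
  have hQ : HasFDerivAt (fun g ↦ ContinuousLinearMap.id ℝ E + l.smulRight (D g))
      ((ContinuousLinearMap.smulRightL ℝ E E l).comp D) 0 :=
    ((ContinuousLinearMap.smulRightL ℝ E E l).comp D).hasFDerivAt.const_add _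
  rw [((hasFDerivAt_const F (0 : E)).clm_comp (hP.clm_comp hQ)).fderiv]
  simp
  ring

-- These are the left-invariant fields of the twisted group; at `0` they take the values `v` and
-- `w`.
variable (l D) in
theorem lieBracket_exp_smul (v w : E) :
    VectorField.lieBracket ℝ (fun x ↦ exp (l x • D) v) (fun x ↦ exp (l x • D) w) 0 =
      l v • D w - l w • D v := by
  rw [VectorField.lieBracket, (hasFDerivAt_exp_smul_apply l D w).fderiv,
    (hasFDerivAt_exp_smul_apply l D v).fderiv]
  simp

variable (l D) in
/-- The semidirect product of `ker l` and `ℝ`, for a derivation `D` with values in `ker l`, as a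
group structure on the vector space `E`. -/
noncomputable abbrev twistedGroup (hl : ∀ x, l (D x) = 0) : Group E where
  mul x y := x + exp (l x • D) y
  one := 0
  inv x := -exp (-l x • D) x
  mul_assoc x y z := by
    change x + exp (l x • D) y + exp (l (x + exp (l x • D) y) • D) z =
      x + exp (l x • D) (y + exp (l y • D) z)
    rw [map_add, apply_exp_smul hl, exp_smul_add_apply, map_add, add_assoc]
  one_mul x := by
    change 0 + exp (l 0 • D) x = x
    simp
  mul_one x := by
    change x + exp (l x • D) 0 = x
    simp
  inv_mul_cancel x := by
    change -exp (-l x • D) x + exp (l (-exp (-l x • D) x) • D) x = 0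
    rw [map_neg, apply_exp_smul hl, neg_add_cancel]

/-- The form `l` is a homomorphism to the additive reals, and on its kernel the law is vector
addition, so the group is an extension of abelian groups. -/
theorem twistedGroup_isSolvable (hl : ∀ x, l (D x) = 0) :
    @Group.IsSolvable E (twistedGroup l D hl) := by
  let _ := twistedGroup l D hl
  let f : E →* Multiplicative ℝ :=
    { toFun := fun x ↦ Multiplicative.ofAdd (l x)
      map_one' := congrArg Multiplicative.ofAdd (map_zero l)
      map_mul' := fun x y ↦ by
        rw [← ofAdd_add, ← apply_exp_smul hl (l x) y, ← map_add]
        rfl }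
  have hker (x : f.ker) : l x = 0 := x.2
  let _ : CommGroup f.ker :=
    { mul_comm := fun x y ↦ by
        apply Subtype.ext
        change (x : E) + exp (l x • D) (y : E) = (y : E) + exp (l y • D) (x : E)
        simp [hker, add_comm] }
  exact Group.isSolvable_of_ker_le_range f.ker.subtype f (by simp)

end TwistedGroup

/-! ### Lie algebra and coadjoint orbits of the twisted group -/

section TwistedLieGroup

open NormedSpace

variable {n : ℕ} {l : StrongDual ℝ (EuclideanSpace ℝ (Fin n))}
  {D : EuclideanSpace ℝ (Fin n) →L[ℝ] EuclideanSpace ℝ (Fin n)}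

local notation "𝔼" => EuclideanSpace ℝ (Fin n)

theorem twistedGroup_lieGroup (hl : ∀ x, l (D x) = 0) :
    letI := twistedGroup l D hl
    LieGroup (𝓡 n) ∞ (EuclideanSpace ℝ (Fin n)) := by
  let _ := twistedGroup l D hl
  have hexp : ContDiff ℝ ∞ fun t : ℝ ↦ exp (t • D) := contDiff_exp_smul D
  refine @LieGroup.mk _ _ _ _ _ _ _ _ _ _ _ _ _ ?_ ?_
  · refine @ContMDiffMul.mk _ _ _ _ _ _ _ _ _ _ _ _ _ _ ?_
    rw [← modelWithCornersSelf_prod, chartedSpaceSelf_prod]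
    refine ContDiff.contMDiff ?_
    change ContDiff ℝ ∞ fun p : 𝔼 × 𝔼 ↦ p.1 + exp (l p.1 • D) p.2
    exact contDiff_fst.add ((hexp.comp (l.contDiff.comp contDiff_fst)).clm_apply contDiff_snd)
  · refine ContDiff.contMDiff ?_
    change ContDiff ℝ ∞ fun x : 𝔼 ↦ -exp (-l x • D) x
    exact ((hexp.comp l.contDiff.neg).clm_apply contDiff_id).neg

/-- Left translation by `g` is affine with linear part `exp (l g • D)`. -/
theorem twistedGroup_mulInvariantVectorField (hl : ∀ x, l (D x) = 0) (v : 𝔼) :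
    letI := twistedGroup l D hl
    mulInvariantVectorField (I := 𝓡 n) (G := 𝔼) v = fun g ↦ exp (l g • D) v := by
  let _ := twistedGroup l D hl
  funext g
  have h : mfderiv (𝓡 n) (𝓡 n) (fun x : 𝔼 ↦ g + exp (l g • D) x) (0 : 𝔼) = exp (l g • D) := by
    rw [mfderiv_eq_fderiv, fderiv_const_add]
    exact (exp (l g • D)).fderiv
  exact congrArg (fun f : 𝔼 →L[ℝ] 𝔼 ↦ f v) h

theorem twistedGroup_bracket (hl : ∀ x, l (D x) = 0) (v w : 𝔼) :
    letI := twistedGroup l D hl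
    (Bracket.bracket (L := GroupLieAlgebra (𝓡 n) 𝔼) (M := GroupLieAlgebra (𝓡 n) 𝔼) v w : 𝔼) =
      l v • D w - l w • D v := by
  let _ := twistedGroup l D hl
  have h : VectorField.mlieBracket (𝓡 n) (fun g : 𝔼 ↦ exp (l g • D) v)
      (fun g : 𝔼 ↦ exp (l g • D) w) (0 : 𝔼) = l v • D w - l w • D v := 
    (mlieBracket_eq_lieBracket _ _ _).trans (lieBracket_exp_smul l D v w)
  rw [← h, ← twistedGroup_mulInvariantVectorField hl v, ← twistedGroup_mulInvariantVectorField hl w]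
  rfl

theorem twistedGroup_groupAd_inv (hl : ∀ x, l (D x) = 0) (g : 𝔼) :
    letI := twistedGroup l D hl
    groupAd (G := 𝔼) n g⁻¹ = (exp (-l g • D)).comp (.id ℝ 𝔼 + l.smulRight (D g)) := by
  let _ := twistedGroup l D hl
  have hf : (fun x : 𝔼 ↦ g⁻¹ * x * g⁻¹⁻¹) =
      fun x ↦ -exp (-l g • D) g + exp (-l g • D) (x + exp (l x • D) g) := by
    funext x
    rw [inv_inv, mul_assoc]
    change -exp (-l g • D) g + exp (l (-exp (-l g • D) g) • D) (x + exp (l x • D) g) = _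
    rw [map_neg, apply_exp_smul hl]
  have h := (hasFDerivAt_twisted_conj l D g).fderiv
  rw [← mfderiv_eq_fderiv, ← hf] at h
  exact h

theorem twistedGroup_coadOrbitTangentSpace (hl : ∀ x, l (D x) = 0) (F : StrongDual ℝ 𝔼) :
    letI := twistedGroup l D hl
    coadOrbitTangentSpace 𝔼 F = LinearMap.range (fderiv ℝ (fun g ↦
      F.comp ((exp (-l g • D)).comp (.id ℝ 𝔼 + l.smulRight (D g)))) 0).toLinearMap := by
  let _ := twistedGroup l D hl
  have hc : (fun g : 𝔼 ↦ groupCoad n g F) =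
      fun g ↦ F.comp ((exp (-l g • D)).comp (.id ℝ 𝔼 + l.smulRight (D g))) :=
    funext fun g ↦ congrArg F.comp (twistedGroup_groupAd_inv hl g)
  rw [← hc]
  exact congrArg (fun f : 𝔼 →L[ℝ] StrongDual ℝ 𝔼 ↦ LinearMap.range f.toLinearMap)
    (mfderiv_eq_fderiv (f := fun g : 𝔼 ↦ groupCoad n g F) (x := (0 : 𝔼)))

open scoped Classical in
/-- The coadjoint orbit of `F` is a point if `F ∘ D = 0`; otherwise its tangent space is spanned by
`l` and `F ∘ D`. -/
theorem twistedGroup_coadOrbitDim (hl : ∀ x, l (D x) = 0) {e : 𝔼} (he : l e = 1) (hDe : D e = 0)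
    (F : StrongDual ℝ 𝔼) :
    letI := twistedGroup l D hl
    coadOrbitDim 𝔼 F = if F.comp D = 0 then 0 else 2 := by
  let _ := twistedGroup l D hl
  have key (f : 𝔼 →L[ℝ] StrongDual ℝ 𝔼) (hf : ∀ u v, f u v = l v * F (D u) - l u * F (D v)) :
      Module.finrank ℝ f.toLinearMap.range = if F.comp D = 0 then 0 else 2 := by
    have hf' (u : 𝔼) : f u = F (D u) • l - l u • F.comp D := by
      ext v
      simp [hf, mul_comm]
    split_ifs with h
    · have h0 : f.toLinearMap = 0 := by
        ext1 u
        have : F (D u) = 0 := congrArg (fun φ : StrongDual ℝ 𝔼 ↦ φ u) h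
        simp [hf', h, this]
      rw [h0, LinearMap.range_zero, finrank_bot]
    · obtain ⟨w, hw⟩ : ∃ w, F (D w) ≠ 0 := by
        by_contra! hw
        exact h (ContinuousLinearMap.ext hw)
      have hr : f.toLinearMap.range = Submodule.span ℝ (Set.range ![l, F.comp D]) := by
        apply le_antisymm
        · rintro _ ⟨u, rfl⟩
          change f u ∈ _
          rw [hf']
          exact sub_mem (Submodule.smul_mem _ _ (Submodule.subset_span ⟨0, rfl⟩))
            (Submodule.smul_mem _ _ (Submodule.subset_span ⟨1, rfl⟩))
        -- Since `l e = 1` and `D e = 0`, the vector `-e` maps to `F ∘ D`; subtracting its multiples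
        -- from `f w` then isolates `l`.
        · have h1 : F.comp D ∈ f.toLinearMap.range := ⟨-e, by
            change f (-e) = _
            ext v
            simp [hf, he, hDe]⟩
          rw [Submodule.span_le, Set.range_subset_iff, Fin.forall_fin_two]
          refine ⟨?_, h1⟩
          have h2 : F (D w) • l ∈ f.toLinearMap.range := by
            have : F (D w) • l = f w + l w • F.comp D := by rw [hf']; abel
            rw [this]
            exact add_mem ⟨w, rfl⟩ (Submodule.smul_mem _ _ h1)
          exact (Submodule.smul_mem_iff _ hw).1 h2
      rw [hr, finrank_span_eq_card]
      · simp
      rw [LinearIndependent.pair_iff]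
      -- Evaluation at `e` kills `F ∘ D` and gives `s = 0`; evaluation at `w` then gives `t = 0`.
      intro s t hst
      have hs : s = 0 := by
        simpa [he, hDe] using congrArg (fun φ : StrongDual ℝ 𝔼 ↦ φ e) hst
      subst hs
      have ht : t * F (D w) = 0 := by
        simpa using congrArg (fun φ : StrongDual ℝ 𝔼 ↦ φ w) hst
      exact ⟨rfl, (mul_eq_zero.1 ht).resolve_right hw⟩
  rw [coadOrbitDim, twistedGroup_coadOrbitTangentSpace hl]
  exact key _ (fderiv_twisted_coadjoint l D F)

open scoped Classical in
theorem twistedGroup_isMDGroup (hl : ∀ x, l (D x) = 0) {e : 𝔼} (he : l e = 1) (hDe : D e = 0) :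
    letI := twistedGroup l D hl
    letI := twistedGroup_lieGroup hl
    IsMDGroup n 𝔼 := by
  let _ := twistedGroup l D hl
  let _ := twistedGroup_lieGroup hl
  refine ⟨inferInstance, inferInstance, twistedGroup_isSolvable hl, fun F ↦ ?_⟩
  simp only [twistedGroup_coadOrbitDim hl he hDe]
  split_ifs
  · exact Or.inl rfl
  · exact Or.inr fun F' ↦ by split_ifs <;> simp

end TwistedLieGroup

/-! ### Lie structures with a commutative ideal of codimension one -/

section SemidirectStructure

variable {V : Type*} [AddCommGroup V] [Module ℝ V]

/-- The Lie structure `[v, w] = l v • D w - l w • D v`, where `D` takes values in `ker l`. -/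
def LieStructure.semidirect (l : V →ₗ[ℝ] ℝ) (D : V →ₗ[ℝ] V) (hl : ∀ x, l (D x) = 0) :
    LieStructure V where
  bracket := LinearMap.mk₂ ℝ (fun v w ↦ l v • D w - l w • D v)
    (fun v v' w ↦ by simp only [map_add]; module)
    (fun c v w ↦ by simp only [map_smul, smul_eq_mul]; module)
    (fun v w w' ↦ by simp only [map_add]; module)
    (fun c v w ↦ by simp only [map_smul, smul_eq_mul]; module)
  bracket_self x := by simp
  jacobi x y z := by
    -- As `l` vanishes on brackets, only terms in `D (D _)` survive, and these cancel cyclically.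
    simp only [LinearMap.mk₂_apply, map_sub, map_smul, hl, zero_smul, sub_zero]
    module

variable {m : ℕ} (X : Module.Basis (Fin (m + 1)) ℝ V)

/-- The embedding of `ℝᵐ` as the span of the first `m` basis vectors. -/
noncomputable def initEmbedding : (Fin m → ℝ) →ₗ[ℝ] V :=
  Fintype.linearCombination ℝ fun i : Fin m ↦ X i.castSucc

/-- The first `m` coordinates in the basis `X`. -/
noncomputable def initCoord : V →ₗ[ℝ] (Fin m → ℝ) :=
  LinearMap.pi fun i ↦ X.coord i.castSucc

/-- The last coordinate in the basis `X`. -/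
noncomputable def lastCoord : V →ₗ[ℝ] ℝ := X.coord (Fin.last m)

theorem initEmbedding_apply (a : Fin m → ℝ) : initEmbedding X a = ∑ i, a i • X i.castSucc :=
  Fintype.linearCombination_apply ℝ _ a

theorem lastCoord_castSucc (i : Fin m) : lastCoord X (X i.castSucc) = 0 := by
  simp [lastCoord, (Fin.castSucc_lt_last i).ne]

theorem lastCoord_last : lastCoord X (X (Fin.last m)) = 1 := by
  simp [lastCoord]

theorem initCoord_castSucc (j : Fin m) : initCoord X (X j.castSucc) = Pi.single j 1 := by
  ext i
  simp [initCoord, Finsupp.single_apply, Pi.single_apply, eq_comm]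

theorem initCoord_last : initCoord X (X (Fin.last m)) = 0 := by
  ext i
  simp [initCoord]

theorem initEmbedding_single (j : Fin m) : initEmbedding X (Pi.single j 1) = X j.castSucc := by
  simp [initEmbedding_apply, Pi.single_apply]

theorem lastCoord_initEmbedding (a : Fin m → ℝ) : lastCoord X (initEmbedding X a) = 0 := by
  simp [initEmbedding_apply, lastCoord_castSucc]

theorem initCoord_initEmbedding (a : Fin m → ℝ) : initCoord X (initEmbedding X a) = a := by
  have h : initCoord X ∘ₗ initEmbedding X = LinearMap.id := by
    refine LinearMap.pi_ext' fun i ↦ LinearMap.ext_ring ?_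
    simp [initEmbedding_single, initCoord_castSucc]
  exact LinearMap.congr_fun h a

theorem initEmbedding_initCoord_add (v : V) :
    initEmbedding X (initCoord X v) + lastCoord X v • X (Fin.last m) = v := by
  have h := X.sum_repr v
  rw [Fin.sum_univ_castSucc] at h
  rw [initEmbedding_apply]
  exact h

theorem initEmbedding_initCoord {v : V} (hv : lastCoord X v = 0) :
    initEmbedding X (initCoord X v) = v := by
  simpa [hv] using initEmbedding_initCoord_add X v

theorem range_initEmbedding : LinearMap.range (initEmbedding X) = spanInit X :=
  Fintype.range_linearCombination ℝ _

theorem finrank_spanInit : Module.finrank ℝ (spanInit X) = m := by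
  rw [spanInit, finrank_span_eq_card, Fintype.card_fin]
  exact X.linearIndependent.comp _ (Fin.castSucc_injective m)

/-- The endomorphism with matrix `A` on the span of the first `m` basis vectors, which kills the
last one. -/
noncomputable def initEnd (A : Matrix (Fin m) (Fin m) ℝ) : V →ₗ[ℝ] V :=
  initEmbedding X ∘ₗ A.mulVecLin ∘ₗ initCoord X

variable (A : Matrix (Fin m) (Fin m) ℝ)

theorem initEnd_apply (v : V) : initEnd X A v = initEmbedding X (A.mulVec (initCoord X v)) := rfl

theorem lastCoord_initEnd (v : V) : lastCoord X (initEnd X A v) = 0 :=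
  lastCoord_initEmbedding X _

theorem initEnd_last : initEnd X A (X (Fin.last m)) = 0 := by
  simp [initEnd_apply, initCoord_last]

theorem initEnd_castSucc (j : Fin m) :
    initEnd X A (X j.castSucc) = ∑ i, A i j • X i.castSucc := by
  simp [initEnd_apply, initCoord_castSucc, initEmbedding_apply]

theorem range_initEnd {A : Matrix (Fin m) (Fin m) ℝ} (hA : IsUnit A) :
    LinearMap.range (initEnd X A) = spanInit X := by
  rw [← range_initEmbedding]
  apply le_antisymm
  · exact LinearMap.range_comp_le_range _ _
  · rintro _ ⟨a, rfl⟩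
    refine ⟨initEmbedding X (A⁻¹.mulVec a), ?_⟩
    rw [initEnd_apply, initCoord_initEmbedding, Matrix.mulVec_mulVec,
      Matrix.mul_nonsing_inv _ ((Matrix.isUnit_iff_isUnit_det A).1 hA), Matrix.one_mulVec]

/-- The Lie structure defined by the matrix `A`. -/
noncomputable def LieStructure.ofMatrix : LieStructure V :=
  .semidirect (lastCoord X) (initEnd X A) (lastCoord_initEnd X A)

theorem LieStructure.ofMatrix_bracket (v w : V) : (LieStructure.ofMatrix X A).bracket v w =
    lastCoord X v • initEnd X A w - lastCoord X w • initEnd X A v := rfl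

theorem LieStructure.ofMatrix_isDefinedBy : (LieStructure.ofMatrix X A).IsDefinedBy X A where
  comm i j := by simp [ofMatrix_bracket, lastCoord_castSucc]
  adMatrix j := by
    simp [ofMatrix_bracket, lastCoord_castSucc, lastCoord_last, initEnd_castSucc]

variable {X A}

theorem LieStructure.IsDefinedBy.eq_ofMatrix {S : LieStructure V} (h : S.IsDefinedBy X A) :
    S = .ofMatrix X A := by
  have h' := LieStructure.ofMatrix_isDefinedBy X A
  refine LieStructure.ext (X.ext fun i ↦ X.ext fun j ↦ ?_)
  induction i using Fin.lastCases with
  | last =>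
    induction j using Fin.lastCases with
    | last => rw [S.bracket_self, LieStructure.bracket_self]
    | cast j => rw [h.adMatrix, h'.adMatrix]
  | cast i =>
    induction j using Fin.lastCases with
    | last => rw [S.bracket_skew (X (Fin.last m)), LieStructure.bracket_skew _ (X (Fin.last m)),
        h.adMatrix, h'.adMatrix]
    | cast j => rw [h.comm, h'.comm]

/-- The first `m` basis vectors lie in the derived ideal, which is commutative; this reduces the
second uniqueness claim to the first. -/
theorem LieStructure.HasDerivedIdealAndAd.isDefinedBy {S : LieStructure V}
    (h : S.HasDerivedIdealAndAd X A) : S.IsDefinedBy X A where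
  comm i j := by
    have hmem (k : Fin m) :
        S.toCarrier (X k.castSucc) ∈ LieAlgebra.derivedSeries ℝ S.Carrier 1 := by
      rw [← LieSubmodule.mem_toSubmodule, h.derived_eq]
      exact ⟨_, Submodule.subset_span ⟨k, rfl⟩, rfl⟩
    have := h.derived_abelian
    exact congrArg Subtype.val
      (trivial_lie_zero _ _ (⟨_, hmem i⟩ : LieAlgebra.derivedSeries ℝ S.Carrier 1) ⟨_, hmem j⟩)
  adMatrix := h.adMatrix

-- Brackets are exactly the values of `D = initEnd X A`: `[v, w] = D (l v • w - l w • v)`, and `D v`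
-- is the bracket of the last basis vector with `v`.
variable (X) in
theorem LieStructure.ofMatrix_derivedSeries (hA : IsUnit A) :
    (LieAlgebra.derivedSeries ℝ (LieStructure.ofMatrix X A).Carrier 1).toSubmodule =
      (spanInit X).map (LieStructure.ofMatrix X A).toCarrier.toLinearMap := by
  refine (LieAlgebra.coe_derivedSeries_one_eq ℝ (ofMatrix X A).Carrier).trans ?_
  rw [← range_initEnd X hA]
  apply le_antisymm
  · rw [Submodule.span_le]
    rintro _ ⟨x, y, rfl⟩
    have h (v w : V) : initEnd X A (lastCoord X v • w - lastCoord X w • v) =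
        (ofMatrix X A).bracket v w := by
      rw [map_sub, map_smul, map_smul, ofMatrix_bracket]
    exact ⟨_, ⟨_, rfl⟩, h x y⟩
  · rintro _ ⟨_, ⟨v, rfl⟩, rfl⟩
    refine Submodule.subset_span
      ⟨(ofMatrix X A).toCarrier (X (Fin.last m)), (ofMatrix X A).toCarrier v, ?_⟩
    rw [LieStructure.lie_toCarrier, ofMatrix_bracket, lastCoord_last, initEnd_last, one_smul,
      smul_zero, sub_zero]
    rfl

theorem lastCoord_eq_zero_of_mem_spanInit {v : V} (hv : v ∈ spanInit X) : lastCoord X v = 0 := by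
  rw [← range_initEmbedding] at hv
  obtain ⟨a, rfl⟩ := hv
  exact lastCoord_initEmbedding X a

variable (X) in
theorem LieStructure.ofMatrix_hasDerivedIdealAndAd (hA : IsUnit A) :
    (LieStructure.ofMatrix X A).HasDerivedIdealAndAd X A where
  derived_abelian := by
    refine ⟨fun x y ↦ Subtype.ext ?_⟩
    have hmem (x : LieAlgebra.derivedSeries ℝ (LieStructure.ofMatrix X A).Carrier 1) :
        ∃ v, lastCoord X v = 0 ∧ (ofMatrix X A).toCarrier v = x := by
      have hx : (x : (ofMatrix X A).Carrier) ∈ (LieAlgebra.derivedSeries ℝ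
        (LieStructure.ofMatrix X A).Carrier 1).toSubmodule := x.2
      rw [LieStructure.ofMatrix_derivedSeries X hA] at hx
      obtain ⟨v, hv, hvx⟩ := hx
      exact ⟨v, lastCoord_eq_zero_of_mem_spanInit hv, hvx⟩
    obtain ⟨v, hv, hvx⟩ := hmem x
    obtain ⟨w, hw, hwy⟩ := hmem y
    change ⁅(x : (ofMatrix X A).Carrier), (y : (ofMatrix X A).Carrier)⁆ = 0
    rw [← hvx, ← hwy, LieStructure.lie_toCarrier, ofMatrix_bracket, hv, hw]
    simp
  derived_eq := LieStructure.ofMatrix_derivedSeries X hA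
  adMatrix := (LieStructure.ofMatrix_isDefinedBy X A).adMatrix

-- The twisted group is built on Euclidean space from the standard basis; matching that basis with
-- `X` carries `l` and `D` over, hence the bracket.
variable (X A) in
theorem LieStructure.ofMatrix_isMDAlgebra :
    IsMDAlgebra (m + 1) (LieStructure.ofMatrix X A).Carrier := by
  let b : Module.Basis (Fin (m + 1)) ℝ (EuclideanSpace ℝ (Fin (m + 1))) :=
    (EuclideanSpace.basisFun (Fin (m + 1)) ℝ).toBasis
  let e : EuclideanSpace ℝ (Fin (m + 1)) ≃ₗ[ℝ] V := b.equiv X (Equiv.refl _)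
  have he (i) : e (b i) = X i := b.equiv_apply i X (Equiv.refl _)
  have hl (v) : lastCoord b v = lastCoord X (e v) := by
    refine LinearMap.congr_fun (f := lastCoord b) (g := lastCoord X ∘ₗ e.toLinearMap)
      (b.ext fun i ↦ ?_) v
    induction i using Fin.lastCases <;> simp [he, lastCoord_last, lastCoord_castSucc]
  have hD (v) : e (initEnd b A v) = initEnd X A (e v) := by
    refine LinearMap.congr_fun (f := e.toLinearMap ∘ₗ initEnd b A)
      (g := initEnd X A ∘ₗ e.toLinearMap) (b.ext fun i ↦ ?_) v
    induction i using Fin.lastCases <;> simp [he, initEnd_last, initEnd_castSucc]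
  have key (v w) : e (lastCoord b v • initEnd b A w - lastCoord b w • initEnd b A v) =
      (ofMatrix X A).bracket (e v) (e w) := by
    rw [ofMatrix_bracket, map_sub, map_smul, map_smul, hl, hl, hD, hD]
  let l : StrongDual ℝ (EuclideanSpace ℝ (Fin (m + 1))) := (lastCoord b).toContinuousLinearMap
  let D := (initEnd b A).toContinuousLinearMap
  have hlD (v) : l (D v) = 0 := lastCoord_initEnd b A v
  let _ := twistedGroup l D hlD
  have hG := twistedGroup_lieGroup hlD
  refine ⟨EuclideanSpace ℝ (Fin (m + 1)), inferInstance, inferInstance, inferInstance, hG,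
    twistedGroup_isMDGroup hlD (lastCoord_last b) (initEnd_last b A),
    ⟨{ e.trans (ofMatrix X A).toCarrier with map_lie' := fun {v w} ↦ ?_ }⟩⟩
  exact (congrArg e (twistedGroup_bracket hlD v w)).trans (key v w)

/-! ### Isomorphisms -/

variable {B : Matrix (Fin m) (Fin m) ℝ}

/-- Invertibility of `A` makes every vector of `ker l` a bracket; its image is again a bracket, and
`l` vanishes on brackets. -/
theorem LieStructure.ofMatrix_equiv_lastCoord (hA : IsUnit A)
    (φ : (LieStructure.ofMatrix X A).Carrier ≃ₗ⁅ℝ⁆ (LieStructure.ofMatrix X B).Carrier)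
    {v : V} (hv : lastCoord X v = 0) : lastCoord X (φ v : V) = 0 := by
  have hv' : v ∈ LinearMap.range (initEnd X A) := by
    rw [range_initEnd X hA, ← range_initEmbedding]
    exact ⟨_, initEmbedding_initCoord X hv⟩
  obtain ⟨w, rfl⟩ := hv'
  have h : initEnd X A w = (ofMatrix X A).bracket (X (Fin.last m)) w := by
    simp [ofMatrix_bracket, lastCoord_last, initEnd_last]
  have h' := φ.map_lie ((ofMatrix X A).toCarrier (X (Fin.last m))) ((ofMatrix X A).toCarrier w)
  rw [LieStructure.lie_toCarrier, ← h] at h'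
  refine (congrArg (lastCoord X) h').trans ?_
  change lastCoord X ((ofMatrix X B).bracket _ _) = 0
  rw [ofMatrix_bracket, map_sub, map_smul, map_smul, lastCoord_initEnd, lastCoord_initEnd]
  simp

theorem LieStructure.exists_conj_of_equiv (hA : IsUnit A)
    (φ : (LieStructure.ofMatrix X A).Carrier ≃ₗ⁅ℝ⁆ (LieStructure.ofMatrix X B).Carrier) :
    ∃ c : ℝ, c ≠ 0 ∧ ∃ C : Matrix (Fin m) (Fin m) ℝ, IsUnit C ∧ c • A = C * B * C⁻¹ := by
  let f : V →ₗ[ℝ] V := φ.toLinearEquiv.toLinearMap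
  let g : V →ₗ[ℝ] V := φ.symm.toLinearEquiv.toLinearMap
  have hgf (v) : g (f v) = v := φ.symm_apply_apply v
  have hfg (v) : f (g v) = v := φ.apply_symm_apply v
  have hf {v} (hv : lastCoord X v = 0) : lastCoord X (f v) = 0 :=
    LieStructure.ofMatrix_equiv_lastCoord hA φ hv
  have hbr (v w) : f (lastCoord X v • initEnd X A w - lastCoord X w • initEnd X A v) =
      lastCoord X (f v) • initEnd X B (f w) - lastCoord X (f w) • initEnd X B (f v) :=
    φ.map_lie v w
  set c := lastCoord X (f (X (Fin.last m))) with hc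
  have hlast (v) : lastCoord X (f v) = lastCoord X v * c := by
    conv_lhs => rw [← initEmbedding_initCoord_add X v]
    rw [map_add, map_add, hf (lastCoord_initEmbedding X _), map_smul, map_smul, smul_eq_mul,
      zero_add]
  have hc0 : c ≠ 0 := by
    intro h0
    -- With `c = 0` the image of `f` would lie in `ker l`, contradicting surjectivity.
    have := hlast (g (X (Fin.last m)))
    rw [hfg, lastCoord_last, h0, mul_zero] at this
    exact one_ne_zero this
  let F := initCoord X ∘ₗ f ∘ₗ initEmbedding X
  let G := initCoord X ∘ₗ g ∘ₗ initEmbedding X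
  have hGF : G ∘ₗ F = LinearMap.id := by
    refine LinearMap.ext fun a ↦ ?_
    change initCoord X (g (initEmbedding X (initCoord X (f (initEmbedding X a))))) = a
    rw [initEmbedding_initCoord X (hf (lastCoord_initEmbedding X a)), hgf, initCoord_initEmbedding]
  have hcomm : F ∘ₗ A.mulVecLin = c • B.mulVecLin ∘ₗ F := by
    refine LinearMap.ext fun a ↦ ?_
    -- The image of the last vector may have a component in `ker l`, but that component commutes
    -- with `f a`; only its last coordinate `c` acts.
    have h := congrArg (initCoord X) (hbr (X (Fin.last m)) (initEmbedding X a))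
    rw [hf (lastCoord_initEmbedding X a), lastCoord_initEmbedding, lastCoord_last, zero_smul,
      zero_smul, one_smul, sub_zero, sub_zero, map_smul, initEnd_apply, initEnd_apply,
      initCoord_initEmbedding, initCoord_initEmbedding] at h
    exact h
  have hM : LinearMap.toMatrix' G * LinearMap.toMatrix' F = 1 := by
    rw [← LinearMap.toMatrix'_comp, hGF, LinearMap.toMatrix'_id]
  have hN : LinearMap.toMatrix' F * A = c • (B * LinearMap.toMatrix' F) := by
    have := congrArg LinearMap.toMatrix' hcomm
    rwa [map_smul, LinearMap.toMatrix'_comp, LinearMap.toMatrix'_comp, ← Matrix.toLin'_apply',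
      ← Matrix.toLin'_apply', LinearMap.toMatrix'_toLin', LinearMap.toMatrix'_toLin'] at this
  have hM' : LinearMap.toMatrix' F * LinearMap.toMatrix' G = 1 := mul_eq_one_comm.1 hM
  -- From `F * A = c • (B * F)` and `G = F⁻¹` one gets `c⁻¹ • A = G * B * G⁻¹`.
  refine ⟨c⁻¹, inv_ne_zero hc0, LinearMap.toMatrix' G, IsUnit.of_mul_eq_one _ hM, ?_⟩
  rw [Matrix.inv_eq_right_inv hM, Matrix.mul_assoc, ← inv_smul_smul₀ hc0
    (B * LinearMap.toMatrix' F), ← hN, Matrix.mul_smul, ← Matrix.mul_assoc, hM, Matrix.one_mul]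

theorem LieStructure.nonempty_equiv_of_conj {c : ℝ} (hc : c ≠ 0) {C : Matrix (Fin m) (Fin m) ℝ}
    (hC : IsUnit C) (h : c • A = C * B * C⁻¹) : Nonempty
      ((LieStructure.ofMatrix X A).Carrier ≃ₗ⁅ℝ⁆ (LieStructure.ofMatrix X B).Carrier) := by
  have hdet := (Matrix.isUnit_iff_isUnit_det C).1 hC
  have h' : C⁻¹ * A = c⁻¹ • (B * C⁻¹) := by
    rw [eq_inv_smul_iff₀ hc, ← Matrix.mul_smul, h, Matrix.mul_assoc, ← Matrix.mul_assoc,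
      Matrix.nonsing_inv_mul _ hdet, Matrix.one_mul]
  -- `f M d` is block diagonal: `M` on the first coordinates, `d` on the last. The isomorphism is `f
  -- C⁻¹ c⁻¹`: the factor `c⁻¹` in `C⁻¹ * A = c⁻¹ • (B * C⁻¹)` is absorbed by the scaling of the
  -- last coordinate.
  let f (M : Matrix (Fin m) (Fin m) ℝ) (d : ℝ) : V →ₗ[ℝ] V :=
    initEnd X M + d • (lastCoord X).smulRight (X (Fin.last m))
  have hf (M d v) : f M d v = initEnd X M v + d • lastCoord X v • X (Fin.last m) := rfl
  have hl (M d v) : lastCoord X (f M d v) = d * lastCoord X v := by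
    simp [hf, lastCoord_initEnd, lastCoord_last]
  have hi (M d v) : initCoord X (f M d v) = M.mulVec (initCoord X v) := by
    simp [hf, initEnd_apply, initCoord_initEmbedding, initCoord_last]
  have hinv {M N : Matrix (Fin m) (Fin m) ℝ} (hMN : M * N = 1) {d d' : ℝ} (hd : d * d' = 1) (v) :
      f M d (f N d' v) = v := by
    rw [hf, hl, initEnd_apply, hi, Matrix.mulVec_mulVec, hMN, Matrix.one_mulVec, ← mul_smul,
      ← mul_assoc, hd, one_mul, initEmbedding_initCoord_add]
  let e : V ≃ₗ[ℝ] V := LinearEquiv.ofLinearMap (f C⁻¹ c⁻¹) (f C c)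
    (LinearMap.ext (hinv (Matrix.nonsing_inv_mul _ hdet) (inv_mul_cancel₀ hc)))
    (LinearMap.ext (hinv (Matrix.mul_nonsing_inv _ hdet) (mul_inv_cancel₀ hc)))
  have hD (v : V) : f C⁻¹ c⁻¹ (initEnd X A v) = c⁻¹ • initEnd X B (f C⁻¹ c⁻¹ v) := by
    rw [hf, lastCoord_initEnd, zero_smul, smul_zero, add_zero, initEnd_apply, initEnd_apply,
      initCoord_initEmbedding, initEnd_apply, hi, Matrix.mulVec_mulVec, Matrix.mulVec_mulVec, h',
      Matrix.smul_mulVec, map_smul]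
  have key (v w : V) : f C⁻¹ c⁻¹ ((ofMatrix X A).bracket v w) =
      (ofMatrix X B).bracket (f C⁻¹ c⁻¹ v) (f C⁻¹ c⁻¹ w) := by
    rw [ofMatrix_bracket, ofMatrix_bracket, map_sub, map_smul, map_smul, hD, hD, hl, hl, smul_smul,
      smul_smul, mul_comm c⁻¹, mul_comm c⁻¹]
  exact ⟨{ ((ofMatrix X A).toCarrier.symm.trans e).trans (ofMatrix X B).toCarrier with
    map_lie' := fun {v w} ↦ key v w }⟩

end SemidirectStructure

theorem theorem4p5 {m : ℕ} (hm : 3 ≤ m + 1) {V : Type*} [AddCommGroup V] [Module ℝ V]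
    (X : Module.Basis (Fin (m + 1)) ℝ V) :
    (∀ A : Matrix (Fin m) (Fin m) ℝ, IsUnit A →
      ∃ S : LieStructure V, S.IsDefinedBy X A ∧
        IsMDAlgebraOfDerivedDim (m + 1) m S.Carrier ∧
        S.HasDerivedIdealAndAd X A ∧
        ∀ T : LieStructure V, T.IsDefinedBy X A ∨ T.HasDerivedIdealAndAd X A → T = S) ∧
    (∀ A B : Matrix (Fin m) (Fin m) ℝ, IsUnit A → IsUnit B →
      ∀ S T : LieStructure V, S.IsDefinedBy X A → T.IsDefinedBy X B →
        (Nonempty (S.Carrier ≃ₗ⁅ℝ⁆ T.Carrier) ↔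
          ∃ c : ℝ, c ≠ 0 ∧ ∃ C : Matrix (Fin m) (Fin m) ℝ, IsUnit C ∧
            c • A = C * B * C⁻¹)) := by
  refine ⟨fun A hA ↦ ⟨.ofMatrix X A, LieStructure.ofMatrix_isDefinedBy X A,
    ⟨by omega, by omega, LieStructure.ofMatrix_isMDAlgebra X A, ?_⟩,
    LieStructure.ofMatrix_hasDerivedIdealAndAd X hA, ?_⟩, fun A B hA _ S T hS hT ↦ ?_⟩
  · change Module.finrank ℝ (LieAlgebra.derivedSeries ℝ _ 1).toSubmodule = m
    rw [LieStructure.ofMatrix_derivedSeries X hA]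
    exact (LinearEquiv.finrank_map_eq _ _).trans (finrank_spanInit X)
  · rintro T (hT | hT)
    · exact hT.eq_ofMatrix
    · exact hT.isDefinedBy.eq_ofMatrix
  · obtain rfl := hS.eq_ofMatrix
    obtain rfl := hT.eq_ofMatrix
    constructor
    · rintro ⟨φ⟩
      exact LieStructure.exists_conj_of_equiv hA φ
    · rintro ⟨c, hc, C, hC, h⟩
      exact LieStructure.nonempty_equiv_of_conj hc hC h
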